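/- Let $n\ge 1$, $r\ge 0$, and let $0=k_0<k_1<\cdots<k_r<k_{r+1}=n$ be integers, $\mathbf k=(k_1,\dots,k_r)$. Let $L\subset\mathbb C^n$ be the linear space of all $\mathbf c=(c_1,\dots,c_n)$ with $c_{k_j+1}=\cdots=c_{k_{j+1}}$ for $j=0,\dots,r$. For $\mathbf c\in L$ let the isospectral model $\mathrm{Fl}_{\mathbf c}(\mathbf k;n)$ be the image of the map $$\mathrm{SO}(n)\to\mathbb C^{n\times n},\qquad Q\mapsto Q\,\mathrm{diag}(c_1,\dots,c_n)\,Q^T,$$ where $\mathrm{SO}(n)=\{Q\in\mathbb C^{n\times n}: QQ^T=\mathrm{Id}_n,\ \det Q=1\}$; it is contained in the affine space of complex symmetric $n\times n$ matrices. Let $X=(x_{ij})$ be a symmetric $n\times n$ matrix of unknowns, $x_{ij}=x_{ji}$, and let $I(\mathrm{Fl}_{\mathbf c}(\mathbf k;n))\subset\mathbb C[X]=\mathbb C[x_{ij}:i\le j]$ be the ideal of all polynomials vanishing on $\mathrm{Fl}_{\mathbf c}(\mathbf k;n)$. Then for generic $\mathbf c\in L$ (that is, for all $\mathbf c$ in some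 nonempty Zariski-open subset of $L$, depending only on $n$ and $\mathbf k$), $\mathrm{Fl}_{\mathbf c}(\mathbf k;n)$ is a Zariski-closed subset of the space of complex symmetric matrices, it is smooth (its coordinate ring $\mathbb C[X]/I(\mathrm{Fl}_{\mathbf c}(\mathbf k;n))$ is a smooth $\mathbb C$-algebra), its ideal $I(\mathrm{Fl}_{\mathbf c}(\mathbf k;n))$ is prime, and $$I(\mathrm{Fl}_{\mathbf c}(\mathbf k;n))=\Big\langle\ \prod_{j=1}^{r+1}(X-c_{k_j}\mathrm{Id}_n),\ \ \mathrm{trace}(X)-\sum_{j=1}^n c_j\ \Big\rangle,$$ where the first generator stands for all entries of the matrix. -/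

import Mathlib

open MvPolynomial

noncomputable section

namespace Isospectral

/-- The type `k = (k_1 < ⋯ < k_r)` of a flag in `n`-space, together with the conventions
`k_0 = 0` and `k_{r+1} = n`; the entry `k_j` is `dim j` for `j = 0, …, r + 1`. -/
structure FlagType (n r : ℕ) where
  dim : Fin (r + 2) → ℕ
  dim_zero : dim 0 = 0
  dim_last : dim (Fin.last (r + 1)) = n
  strictMono : StrictMono dim

variable {n r : ℕ}

/-- The last position of the `j`-th block (`j = 0, …, r`), i.e. the position `k_{j+1}` of
`{1, …, n}`, which is `k_{j+1} - 1` when positions are counted from zero. -/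
def FlagType.lastPos (k : FlagType n r) (j : Fin (r + 1)) : Fin n :=
  ⟨k.dim j.succ - 1, by
    have h1 : k.dim j.castSucc < k.dim j.succ := k.strictMono Fin.castSucc_lt_succ
    have h2 : k.dim j.succ ≤ k.dim (Fin.last (r + 1)) := k.strictMono.monotone (Fin.le_last _)
    have h3 := k.dim_last
    omega⟩

/-- `c_{k_j + 1} = ⋯ = c_{k_{j+1}}` for `j = 0, …, r`. -/
def FlagType.IsBlockConstant (k : FlagType n r) (c : Fin n → ℂ) : Prop :=
  ∀ (j : Fin (r + 1)) (i i' : Fin n),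
    k.dim j.castSucc ≤ (i : ℕ) → (i : ℕ) < k.dim j.succ →
    k.dim j.castSucc ≤ (i' : ℕ) → (i' : ℕ) < k.dim j.succ → c i = c i'

/-- A property holds for a generic block-constant vector: there is a Zariski-open subset of the
linear space of all block-constant vectors that is non-empty and on which the property holds. -/
def FlagType.Generic (k : FlagType n r) (P : (Fin n → ℂ) → Prop) : Prop :=
  ∃ g : MvPolynomial (Fin n) ℂ,
    (∃ c, k.IsBlockConstant c ∧ eval c g ≠ 0) ∧
    ∀ c, k.IsBlockConstant c → eval c g ≠ 0 → P c

/-- The image of `SO(n) → ℂ^{n × n}`, `Q ↦ Q diag(c) Qᵀ`, where `SO(n)` is the complex special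
orthogonal group. -/
def model (c : Fin n → ℂ) : Set (Matrix (Fin n) (Fin n) ℂ) :=
  {X | ∃ Q ∈ Matrix.specialOrthogonalGroup (Fin n) ℂ, X = Q * Matrix.diagonal c * Q.transpose}

/-- The symmetric matrix with entries `x_{ij} = x_{ji}`. -/
def symMatrix {R : Type*} (x : Sym2 (Fin n) → R) : Matrix (Fin n) (Fin n) R :=
  Matrix.of fun i j => x s(i, j)

theorem symMatrix_isSymm {R : Type*} (x : Sym2 (Fin n) → R) : (symMatrix x).IsSymm := by
  ext i j
  simp [symMatrix, Sym2.eq_swap]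

/-- Every point of the model is symmetric, so it is given by symmetric coordinates. -/
theorem exists_symMatrix_eq_of_mem_model {c : Fin n → ℂ} {X : Matrix (Fin n) (Fin n) ℂ}
    (hX : X ∈ model c) : ∃ x : Sym2 (Fin n) → ℂ, symMatrix x = X := by
  obtain ⟨Q, -, rfl⟩ := hX
  have h : (Q * Matrix.diagonal c * Q.transpose).IsSymm := by
    simp [Matrix.IsSymm, Matrix.transpose_mul, Matrix.mul_assoc]
  refine ⟨Sym2.lift ⟨fun i j => (Q * Matrix.diagonal c * Q.transpose) i j,
    fun i j => h.apply j i⟩, ?_⟩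
  ext i j
  simp [symMatrix]

/-- The model as a subset of the affine space of complex symmetric `n × n` matrices, whose
coordinates are indexed by unordered pairs `{i, j}` with `i = j` allowed. -/
def modelPoints (c : Fin n → ℂ) : Set (Sym2 (Fin n) → ℂ) :=
  {x | symMatrix x ∈ model c}

/-- The polynomial ring `ℂ[x_{ij} : i ≤ j]` in the entries of a symmetric matrix of unknowns. -/
abbrev CoordRing (n : ℕ) : Type := MvPolynomial (Sym2 (Fin n)) ℂ

/-- The symmetric matrix `X` of unknowns. -/
def genericSym (n : ℕ) : Matrix (Fin n) (Fin n) (CoordRing n) :=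
  symMatrix fun e => MvPolynomial.X e

/-- The matrix `∏_{j=1}^{r+1} (X - c_{k_j} Id)` over the polynomial ring. -/
def minPolyMatrix (k : FlagType n r) (c : Fin n → ℂ) : Matrix (Fin n) (Fin n) (CoordRing n) :=
  (List.ofFn fun j : Fin (r + 1) =>
    genericSym n - (C (c (k.lastPos j)) : CoordRing n) •
      (1 : Matrix (Fin n) (Fin n) (CoordRing n))).prod

/-- The ideal generated by the entries of `∏_{j=1}^{r+1} (X - c_{k_j} Id)` and by
`trace X - ∑ c_j`. -/
def definingIdeal (k : FlagType n r) (c : Fin n → ℂ) : Ideal (CoordRing n) :=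
  Ideal.span (Set.range (fun p : Fin n × Fin n => minPolyMatrix k c p.1 p.2) ∪
    {(genericSym n).trace - C (∑ i, c i)})

end Isospectral

end

/-! For generic `c` the block values are distinct, so the minimal polynomial p of diag(c) is
separable, and the trace determines the multiplicities of its roots. A symmetric X with p(X) = 0 has
symmetric spectral projectors, the Lagrange basis polynomials evaluated at X. Hence X is
orthogonally diagonalizable over ℂ (`exists_orthonormal_eigenvectors`), and the trace forces the
spectrum to be `c`: the equations have the right zero set (`zeroLocus_definingIdeal`).

Primality needs no genericity: the Cayley transform parametrizes the model by a principal open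
subset of an affine space, so the vanishing ideal is the kernel of a map into a domain
(`ker_parametrization`).

That the equations generate the whole vanishing ideal may be checked on infinitesimal neighbourhoods
of closed points (`eq_zero_of_forall_infinitesimal`). There, two solutions with the same closed
point are orthogonally conjugate (`exists_orthogonal_conj_of_map_eq`), so every solution is a
specialization of the Cayley parametrization and is annihilated by each polynomial vanishing on the
model.

For smoothness, Newton's method for p lifts solutions through square-zero thickenings and preserves
symmetry; the trace equation then holds automatically, since p(X) = 0 makes the trace locally
constant (`trace_eq_of_forall_point`). -/

namespace Isospectral

/-! ### Spectral projectors and orthogonal conjugacy over nilpotent thickenings. -/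

section LinearAlgebra

open scoped Polynomial
open Matrix Lagrange

variable {ι κ : Type*} [Fintype ι] [DecidableEq ι] [Fintype κ]

theorem transpose_aeval {A R : Type*} [CommRing A] [CommRing R] [Algebra A R]
    (M : Matrix ι ι R) (q : A[X]) : (Polynomial.aeval M q)ᵀ = Polynomial.aeval Mᵀ q := by
  induction q using Polynomial.induction_on' with
  | add p q hp hq => simp [hp, hq, transpose_add]
  | monomial k a =>
    simp [Polynomial.aeval_monomial, Algebra.algebraMap_eq_smul_one, transpose_pow]

theorem aeval_map_algHom {A R R' : Type*} [CommRing A] [CommRing R] [CommRing R'] [Algebra A R]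
    [Algebra A R'] (π : R →ₐ[A] R') (M : Matrix ι ι R) (q : A[X]) :
    (Polynomial.aeval M q).map π = Polynomial.aeval (M.map π) q :=
  (Polynomial.aeval_algHom_apply π.mapMatrix M q).symm

/-- Truncations of the power series of `1 / √(1 + X)`. -/
theorem exists_sq_mul_one_add_X_sub_one_dvd (N : ℕ) :
    ∃ q : ℂ[X], q.eval 0 = 1 ∧
      Polynomial.X ^ (N + 1) ∣ q ^ 2 * (1 + Polynomial.X) - 1 := by
  induction N with
  | zero => exact ⟨1, by simp, by simp⟩
  | succ N ih =>
    obtain ⟨q, hq, h, hh⟩ := ih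
    -- Since q(0) = 1, subtracting a X^(N+1) from q lowers the coefficient of X^(N+1) in q²(1 + X)
    -- by 2a, so a = h(0)/2 cancels the leading error.
    refine ⟨q - Polynomial.C (h.eval 0 / 2) * Polynomial.X ^ (N + 1), by simp [hq], ?_⟩
    have key : (q - Polynomial.C (h.eval 0 / 2) * Polynomial.X ^ (N + 1)) ^ 2
        * (1 + Polynomial.X) - 1 = Polynomial.X ^ (N + 1) *
        (h - 2 * Polynomial.C (h.eval 0 / 2) * q * (1 + Polynomial.X)
          + Polynomial.C (h.eval 0 / 2) ^ 2 * Polynomial.X ^ (N + 1) * (1 + Polynomial.X)) := by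
      linear_combination hh
    rw [key, pow_succ _ (N + 1)]
    refine mul_dvd_mul_left _ ?_
    rw [Polynomial.X_dvd_iff, Polynomial.coeff_zero_eq_eval_zero]
    simp [hq]
    ring

theorem pow_apply_mem_pow {R : Type*} [CommRing R] {I : Ideal R} {M : Matrix ι ι R}
    (hM : ∀ i j, M i j ∈ I) (N : ℕ) (i j : ι) : (M ^ N) i j ∈ I ^ N := by
  induction N generalizing i j with
  | zero => simp
  | succ N ih =>
    rw [pow_succ, pow_succ, Matrix.mul_apply]
    exact Ideal.sum_mem _ fun l _ => Ideal.mul_mem_mul (ih i l) (hM l j)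

theorem nodal_dvd_of_eval_eq_zero {b : κ → ℂ} (hb : Function.Injective b) {f : ℂ[X]}
    (hf : ∀ j, f.eval (b j) = 0) : nodal Finset.univ b ∣ f := by
  rw [nodal_eq]
  refine Finset.prod_dvd_of_coprime (fun i _ j _ hij => ?_)
    fun j _ => Polynomial.dvd_iff_isRoot.mpr (hf j)
  exact Polynomial.pairwise_coprime_X_sub_C hb hij

/-- Evaluation at `x` factors through ℂ[X]/∏(X - b_j), so identities between spectral projectors
reduce to comparing values at the nodes. -/
theorem aeval_eq_aeval_of_nodal {A : Type*} [Ring A] [Algebra ℂ A] {b : κ → ℂ}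
    (hb : Function.Injective b) {x : A} (hx : Polynomial.aeval x (nodal Finset.univ b) = 0)
    {f g : ℂ[X]} (hfg : ∀ j, f.eval (b j) = g.eval (b j)) :
    Polynomial.aeval x f = Polynomial.aeval x g := by
  obtain ⟨h, hh⟩ := nodal_dvd_of_eval_eq_zero hb (f := f - g) fun j => by simp [hfg]
  rw [← sub_eq_zero, ← map_sub, hh, map_mul, hx, zero_mul]

theorem commute_aeval {A : Type*} [Ring A] [Algebra ℂ A] {x y : A} (h : Commute x y) (f : ℂ[X]) :
    Commute x (Polynomial.aeval y f) := by
  induction f using Polynomial.induction_on' with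
  | add p q hp hq => simpa using hp.add_right hq
  | monomial k a =>
    rw [Polynomial.aeval_monomial]
    exact (Algebra.commute_algebraMap_right a x).mul_right (h.pow_right k)

variable [DecidableEq κ]

theorem eval_basis_node {b : κ → ℂ} (hb : Function.Injective b) (i j : κ) :
    (Lagrange.basis Finset.univ b i).eval (b j) = if i = j then 1 else 0 := by
  split_ifs with h
  · subst h
    exact eval_basis_self hb.injOn (Finset.mem_univ _)
  · exact eval_basis_of_ne h (Finset.mem_univ _)

theorem mul_aeval_basis {A : Type*} [Ring A] [Algebra ℂ A] {b : κ → ℂ}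
    (hb : Function.Injective b) {x : A} (hx : Polynomial.aeval x (nodal Finset.univ b) = 0)
    (j : κ) : x * Polynomial.aeval x (Lagrange.basis Finset.univ b j)
      = b j • Polynomial.aeval x (Lagrange.basis Finset.univ b j) := by
  have := aeval_eq_aeval_of_nodal hb hx (f := Polynomial.X * Lagrange.basis Finset.univ b j)
    (g := Polynomial.C (b j) * Lagrange.basis Finset.univ b j) fun i => by
      rw [Polynomial.eval_mul, Polynomial.eval_mul, eval_basis_node hb]
      aesop
  simpa [Algebra.smul_def] using this

theorem aeval_basis_mul_self {A : Type*} [Ring A] [Algebra ℂ A] {b : κ → ℂ}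
    (hb : Function.Injective b) {x : A} (hx : Polynomial.aeval x (nodal Finset.univ b) = 0)
    (j : κ) : Polynomial.aeval x (Lagrange.basis Finset.univ b j)
      * Polynomial.aeval x (Lagrange.basis Finset.univ b j)
      = Polynomial.aeval x (Lagrange.basis Finset.univ b j) := by
  rw [← map_mul]
  refine aeval_eq_aeval_of_nodal hb hx fun i => ?_
  rw [Polynomial.eval_mul, eval_basis_node hb]
  simp

theorem sum_aeval_basis {A : Type*} [Ring A] [Algebra ℂ A] {b : κ → ℂ}
    (hb : Function.Injective b) {x : A} (hx : Polynomial.aeval x (nodal Finset.univ b) = 0) :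
    ∑ j, Polynomial.aeval x (Lagrange.basis Finset.univ b j) = 1 := by
  rw [← map_sum, ← map_one (Polynomial.aeval (R := ℂ) x)]
  refine aeval_eq_aeval_of_nodal hb hx fun i => ?_
  rw [Polynomial.eval_finsetSum]
  simp [eval_basis_node hb]

/-- Two symmetric matrices that are annihilated by a separable polynomial and agree modulo a
nilpotent ideal are conjugate under an orthogonal matrix that is trivial modulo that ideal. -/
theorem exists_orthogonal_conj_of_map_eq {R R' : Type*} [CommRing R] [CommRing R'] [Algebra ℂ R]
    [Algebra ℂ R'] (π : R →ₐ[ℂ] R') {N : ℕ} (hπ : RingHom.ker π ^ N = ⊥) {b : κ → ℂ}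
    (hb : Function.Injective b) {M M₀ : Matrix ι ι R} (hs : M.IsSymm) (hs₀ : M₀.IsSymm)
    (hM : Polynomial.aeval M (nodal Finset.univ b) = 0)
    (hM₀ : Polynomial.aeval M₀ (nodal Finset.univ b) = 0) (hMM₀ : M.map π = M₀.map π) :
    ∃ Q : Matrix ι ι R, Qᵀ * Q = 1 ∧ Q.map π = 1 ∧ M = Q * M₀ * Qᵀ := by
  set E : κ → Matrix ι ι R := fun j => Polynomial.aeval M (Lagrange.basis Finset.univ b j) with hE
  set E₀ : κ → Matrix ι ι R :=
    fun j => Polynomial.aeval M₀ (Lagrange.basis Finset.univ b j) with hE₀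
  -- U carries each eigenspace of M₀ into that of M, and modulo the kernel it becomes ∑ E_j² = 1. It
  -- need not be orthogonal.
  set U := ∑ j, E j * E₀ j with hU
  have hMU : M * U = U * M₀ := by
    rw [hU, Finset.mul_sum, Finset.sum_mul]
    refine Finset.sum_congr rfl fun j _ => ?_
    rw [mul_assoc, ← (commute_aeval (Commute.refl M₀) _).eq, mul_aeval_basis hb hM₀,
      ← mul_assoc, mul_aeval_basis hb hM, smul_mul_assoc, mul_smul_comm]
  have hUM : Uᵀ * M = M₀ * Uᵀ := by
    have := congrArg transpose hMU
    rw [transpose_mul, transpose_mul, hs.eq, hs₀.eq] at this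
    exact this
  have hUπ : U.map π = 1 := by
    have h1 : Polynomial.aeval (M₀.map π) (nodal Finset.univ b) = 0 := by
      rw [← aeval_map_algHom, hM₀]
      simp
    have : U.map π = ∑ j, (E j).map π * (E₀ j).map π := by
      change π.mapMatrix U = ∑ j, π.mapMatrix (E j) * π.mapMatrix (E₀ j)
      simp [hU]
    rw [this, ← sum_aeval_basis hb h1]
    refine Finset.sum_congr rfl fun j _ => ?_
    rw [hE, hE₀, aeval_map_algHom, aeval_map_algHom, hMM₀, aeval_basis_mul_self hb h1]
  set K := Uᵀ * U - 1 with hK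
  have hKt : Kᵀ = K := by simp [hK, transpose_mul]
  have hKM : Commute M₀ K := by
    refine Commute.sub_right ?_ (Commute.one_right _)
    change M₀ * (Uᵀ * U) = Uᵀ * U * M₀
    rw [← mul_assoc, ← hUM, mul_assoc, hMU, mul_assoc]
  have hKπ : K.map π = 0 := by
    have h2 : Uᵀ.map π = 1 := by rw [transpose_map, hUπ, transpose_one]
    change π.mapMatrix K = 0
    rw [hK, map_sub, map_mul, map_one]
    change Uᵀ.map π * U.map π - 1 = 0
    rw [h2, hUπ]
    simp
  have hKN : K ^ (N + 1) = 0 := by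
    have hmem : ∀ i j, K i j ∈ RingHom.ker π := fun i j =>
      (RingHom.mem_ker).mpr (congrFun (congrFun hKπ i) j)
    have h0 : K ^ N = 0 := by
      ext i j
      have := pow_apply_mem_pow hmem N i j
      rwa [hπ, Ideal.mem_bot] at this
    rw [pow_succ, h0, zero_mul]
  obtain ⟨q, hq0, hq⟩ := exists_sq_mul_one_add_X_sub_one_dvd N
  -- W is an inverse square root of UᵀU = 1 + K, exact because K is nilpotent. As a polynomial in K
  -- it is symmetric and commutes with M₀, so UW is orthogonal and still intertwines.
  set W := Polynomial.aeval K q with hW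
  have hWt : Wᵀ = W := by rw [hW, transpose_aeval, hKt]
  have hWK : W * W * (Uᵀ * U) = 1 := by
    obtain ⟨h, hh⟩ := hq
    have := congrArg (Polynomial.aeval K) hh
    simp only [map_sub, map_mul, map_pow, map_add, map_one, Polynomial.aeval_X, hKN,
      zero_mul] at this
    rw [← hW, sub_eq_zero, sq, hK, add_sub_cancel] at this
    exact this
  have hWc : Commute W (Uᵀ * U) := by
    have : Commute W (K + 1) :=
      (commute_aeval (Commute.refl K) q).symm.add_right (Commute.one_right _)
    rwa [hK, sub_add_cancel] at this
  have hQ : (U * W)ᵀ * (U * W) = 1 := by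
    rw [transpose_mul, hWt, ← hWK, mul_assoc W W, hWc.eq]
    simp only [mul_assoc]
  refine ⟨U * W, hQ, ?_, ?_⟩
  · change π.mapMatrix (U * W) = 1
    rw [map_mul]
    change U.map π * W.map π = 1
    rw [hUπ, hW, aeval_map_algHom, hKπ, one_mul]
    have : Polynomial.aeval (0 : Matrix ι ι R') q = algebraMap ℂ _ (q.eval 0) := by
      rw [← map_zero (algebraMap ℂ (Matrix ι ι R')), Polynomial.aeval_algebraMap_apply]
      simp
    rw [this, hq0, map_one]
  · have h3 : M * (U * W) = U * W * M₀ := by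
      rw [← mul_assoc, hMU, mul_assoc, mul_assoc, (commute_aeval hKM q).eq]
    rw [← h3, mul_assoc, mul_eq_one_comm.mp hQ, mul_one]

end LinearAlgebra

end Isospectral

namespace Isospectral

/-! ### Detecting zero infinitesimally; orthogonal diagonalization over ℂ. -/

section LinearAlgebra

open scoped Polynomial
open Matrix Lagrange

/-- An element of a `ℂ`-algebra of finite type is zero as soon as it vanishes on all infinitesimal
neighbourhoods of all closed points. -/
theorem eq_zero_of_forall_infinitesimal {B : Type*} [CommRing B] [Algebra ℂ B]
    [Algebra.FiniteType ℂ B] (x : B)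
    (h : ∀ (J : Ideal B) (π : (B ⧸ J) →ₐ[ℂ] ℂ) (N : ℕ), RingHom.ker π ^ N = ⊥ →
      Ideal.Quotient.mk J x = 0) : x = 0 := by
  have : IsNoetherianRing B := Algebra.FiniteType.isNoetherianRing ℂ B
  by_contra hx
  have hne : Ideal.span {x} ≠ ⊥ := by simpa using hx
  -- The annihilator of a nonzero x lies in some maximal ideal m. If x were in every power of m,
  -- Krull's intersection theorem would give r in m with (1 - r)x = 0, hence 1 - r in m, which is
  -- absurd.
  have htop : (⊥ : Ideal B).colon (Ideal.span {x} : Set B) ≠ ⊤ := by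
    intro h1
    have : (1 : B) ∈ (⊥ : Ideal B).colon (Ideal.span {x} : Set B) := h1 ▸ Submodule.mem_top
    have := Submodule.mem_colon.mp this x (Ideal.subset_span rfl)
    simp at this
    exact hx this
  obtain ⟨m, hm, hle⟩ := Ideal.exists_le_maximal _ htop
  let : Field (B ⧸ m) := Ideal.Quotient.field m
  have hfin : Module.Finite ℂ (B ⧸ m) := finite_of_finite_type_of_isJacobsonRing ℂ (B ⧸ m)
  let e : ℂ ≃ₐ[ℂ] (B ⧸ m) := AlgEquiv.ofBijective (Algebra.ofId ℂ (B ⧸ m))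
    IsAlgClosed.algebraMap_bijective_of_isIntegral
  let χ : B →ₐ[ℂ] ℂ := (e.symm : (B ⧸ m) →ₐ[ℂ] ℂ).comp (Ideal.Quotient.mkₐ ℂ m)
  have hχ : ∀ y, χ y = 0 ↔ y ∈ m := fun y => by
    simp [χ, Ideal.Quotient.eq_zero_iff_mem]
  have hmem : ∀ N, x ∈ m ^ N := fun N => by
    rcases Nat.eq_zero_or_pos N with rfl | hN
    · simp
    have hle' : ∀ a ∈ m ^ N, χ a = 0 := fun a ha => (hχ a).mpr (Ideal.pow_le_self hN.ne' ha)
    refine Ideal.Quotient.eq_zero_iff_mem.mp (h (m ^ N) (Ideal.Quotient.liftₐ _ χ hle') N ?_)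
    have hker : RingHom.ker (Ideal.Quotient.liftₐ (m ^ N) χ hle')
        ≤ m.map (Ideal.Quotient.mk (m ^ N)) := by
      intro z hz
      obtain ⟨y, rfl⟩ := Ideal.Quotient.mk_surjective z
      exact Ideal.mem_map_of_mem _ ((hχ y).mp hz)
    rw [eq_bot_iff]
    refine (Ideal.pow_right_mono hker N).trans ?_
    rw [← Ideal.map_pow, Ideal.map_quotient_self]
  obtain ⟨r, hr⟩ := (Ideal.mem_iInf_smul_pow_eq_bot_iff m x).mp (by
    simpa [Submodule.mem_iInf] using hmem)
  have hr' : (1 - (r : B)) ∈ m := by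
    refine hle (Submodule.mem_colon.mpr fun y hy => ?_)
    obtain ⟨z, rfl⟩ := Ideal.mem_span_singleton'.mp hy
    simp only [smul_eq_mul] at hr ⊢
    rw [Ideal.mem_bot]
    linear_combination (-z) * hr
  exact hm.ne_top ((Ideal.eq_top_iff_one m).mpr (by simpa using m.add_mem hr' r.2))

/-- The determinant is affine in the first sign, with slope the complementary minor, nonzero by
induction. So it cannot vanish at both 1 and -1. -/
theorem exists_sign_det_ne_zero {n : ℕ} (M : Matrix (Fin n) (Fin n) ℂ) :
    ∃ e : Fin n → ℂ, (∀ i, e i * e i = 1) ∧ (diagonal e + M).det ≠ 0 := by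
  induction n with
  | zero => exact ⟨1, by simp, by simp⟩
  | succ n ih =>
    obtain ⟨e, he, hdet⟩ := ih (M.submatrix Fin.succ Fin.succ)
    have hsub : ∀ t : ℂ, ∀ j, (diagonal (Fin.cons t e : Fin (n + 1) → ℂ) + M).submatrix Fin.succ j
        = (diagonal (Fin.cons 0 e : Fin (n + 1) → ℂ) + M).submatrix Fin.succ (j : Fin n → _) := by
      intro t j
      ext i l
      simp [diagonal_apply]
    have hsub0 : (diagonal (Fin.cons 0 e : Fin (n + 1) → ℂ) + M).submatrix Fin.succ Fin.succ
        = diagonal e + M.submatrix Fin.succ Fin.succ := by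
      ext i l
      simp [diagonal_apply]
    have key : ∀ t : ℂ, (diagonal (Fin.cons t e : Fin (n + 1) → ℂ) + M).det
        = t * (diagonal e + M.submatrix Fin.succ Fin.succ).det
          + (diagonal (Fin.cons 0 e : Fin (n + 1) → ℂ) + M).det := by
      intro t
      rw [det_succ_row_zero, det_succ_row_zero (diagonal (Fin.cons 0 e) + M), Fin.sum_univ_succ,
        Fin.sum_univ_succ]
      simp only [hsub t, Fin.succAbove_zero, hsub0]
      simp [(Fin.succ_ne_zero _).symm]
      ring
    by_cases h1 : (diagonal (Fin.cons 1 e : Fin (n + 1) → ℂ) + M).det = 0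
    · refine ⟨Fin.cons (-1) e, Fin.cases (by simp) (by simpa using he), fun h2 => hdet ?_⟩
      rw [key] at h1 h2
      linear_combination (h1 - h2) / 2
    · exact ⟨Fin.cons 1 e, Fin.cases (by simp) (by simpa using he), h1⟩

variable {ι κ : Type*} [Fintype ι] [DecidableEq ι] [Fintype κ] [DecidableEq κ]

/-- Complex eigenvectors can be isotropic, so normalizing an arbitrary one may fail. Instead, let F
be the projector onto the orthogonal complement of the vectors found so far. Its trace is nonzero,
so some symmetric idempotent G = E_j F has G i i ≠ 0. Column i of G is a b_j-eigenvector with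
self-product G i i, and is divided by a square root of it. -/
theorem exists_orthonormal_eigenvectors {b : κ → ℂ} (hb : Function.Injective b)
    {M : Matrix ι ι ℂ} (hs : M.IsSymm) (hM : Polynomial.aeval M (nodal Finset.univ b) = 0)
    (k : ℕ) (hk : k ≤ Fintype.card ι) :
    ∃ (V : Matrix ι (Fin k) ℂ) (s : Fin k → κ), Vᵀ * V = 1 ∧ M * V = V * diagonal (b ∘ s) := by
  induction k with
  | zero => exact ⟨0, Fin.elim0, by ext i; exact i.elim0, by ext i j; exact j.elim0⟩
  | succ k ih =>
    obtain ⟨V, s, hV, hMV⟩ := ih (by omega)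
    have hVM : Vᵀ * M = diagonal (b ∘ s) * Vᵀ := by
      have := congrArg transpose hMV
      rwa [transpose_mul, transpose_mul, hs.eq, diagonal_transpose] at this
    set F : Matrix ι ι ℂ := 1 - V * Vᵀ with hF
    have hFt : Fᵀ = F := by simp [hF, transpose_mul]
    have hVF : Vᵀ * F = 0 := by 
      rw [hF, Matrix.mul_sub, ← Matrix.mul_assoc, hV, Matrix.one_mul, Matrix.mul_one, sub_self]
    have hFF : F * F = F := by
      change (1 - V * Vᵀ) * F = F
      rw [Matrix.sub_mul, Matrix.mul_assoc, hVF, Matrix.mul_zero, sub_zero, Matrix.one_mul]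
    have hFM : Commute F M := by
      refine Commute.sub_left (Commute.one_left _) ?_
      change V * Vᵀ * M = M * (V * Vᵀ)
      rw [Matrix.mul_assoc, hVM, ← Matrix.mul_assoc, ← Matrix.mul_assoc, hMV]
    set E : κ → Matrix ι ι ℂ := fun j => Polynomial.aeval M (Lagrange.basis Finset.univ b j) with hE
    have htr : F.trace ≠ 0 := by
      rw [hF, trace_sub, trace_mul_comm, hV, trace_one, trace_one, Fintype.card_fin, sub_ne_zero]
      exact_mod_cast (by omega : Fintype.card ι ≠ k)
    obtain ⟨j, i, hij⟩ : ∃ j i, (E j * F) i i ≠ 0 := by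
      by_contra! hcon
      refine htr ?_
      rw [← one_mul F, ← sum_aeval_basis hb hM, Finset.sum_mul, trace_sum]
      exact Finset.sum_eq_zero fun j _ => Finset.sum_eq_zero fun i _ => hcon j i
    set G := E j * F with hG
    have hEF : Commute F (E j) := commute_aeval hFM _
    have hGt : Gᵀ = G := by
      rw [hG, transpose_mul, hFt, hE, transpose_aeval, hs.eq]
      exact hEF.eq
    have hGG : G * G = G := by
      calc E j * F * (E j * F) = E j * (F * E j) * F := by simp only [mul_assoc]
        _ = (E j * E j) * (F * F) := by rw [hEF.eq]; simp only [mul_assoc]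
        _ = _ := by rw [hFF, aeval_basis_mul_self hb hM]
    have hMG : M * G = b j • G := by
      rw [hG, ← mul_assoc, mul_aeval_basis hb hM, smul_mul_assoc]
    have hVG : Vᵀ * G = 0 := by
      rw [hG, ← hEF.eq, ← Matrix.mul_assoc, hVF, Matrix.zero_mul]
    obtain ⟨z, hz⟩ := IsAlgClosed.exists_pow_nat_eq (G i i) two_pos
    have hz0 : z ≠ 0 := by
      rintro rfl
      exact hij (by simpa using hz.symm)
    let W : Matrix ι (Fin (k + 1)) ℂ := of fun a => Fin.snoc (V a) (z⁻¹ * G a i)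
    have hW1 : ∀ a l, W a (Fin.castSucc l) = V a l := fun a l => by simp [W]
    have hW2 : ∀ a, W a (Fin.last k) = z⁻¹ * G a i := fun a => by simp [W]
    have o1 : ∀ l m, ∑ a, V a l * V a m = if l = m then 1 else 0 := fun l m => by
      have := congrFun (congrFun hV l) m
      simpa [Matrix.mul_apply, Matrix.one_apply] using this
    have o2 : ∀ l, ∑ a, V a l * G a i = 0 := fun l => by
      have := congrFun (congrFun hVG l) i
      simpa [Matrix.mul_apply] using this
    have o3 : ∑ a, G a i * G a i = G i i := by
      have := congrFun (congrFun hGG i) i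
      rw [Matrix.mul_apply] at this
      rw [← this]
      exact Finset.sum_congr rfl fun a _ => by
        rw [← congrFun (congrFun hGt i) a, transpose_apply]
    refine ⟨W, Fin.snoc s j, ?_, ?_⟩
    · ext l m
      rw [Matrix.mul_apply]
      simp only [transpose_apply]
      refine Fin.lastCases ?_ (fun l => ?_) l <;> refine Fin.lastCases ?_ (fun m => ?_) m
      · simp only [hW2, one_apply_eq]
        calc ∑ a, z⁻¹ * G a i * (z⁻¹ * G a i) = (z⁻¹) ^ 2 * ∑ a, G a i * G a i := by
              rw [Finset.mul_sum]
              exact Finset.sum_congr rfl fun a _ => by ring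
          _ = 1 := by rw [o3, ← hz]; field_simp
      · simp only [hW1, hW2]
        rw [one_apply_ne (Fin.castSucc_lt_last m).ne']
        calc ∑ a, z⁻¹ * G a i * V a m = z⁻¹ * ∑ a, V a m * G a i := by
              rw [Finset.mul_sum]
              exact Finset.sum_congr rfl fun a _ => by ring
          _ = 0 := by rw [o2, mul_zero]
      · simp only [hW1, hW2]
        rw [one_apply_ne (Fin.castSucc_lt_last l).ne]
        calc ∑ a, V a l * (z⁻¹ * G a i) = z⁻¹ * ∑ a, V a l * G a i := by
              rw [Finset.mul_sum]
              exact Finset.sum_congr rfl fun a _ => by ring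
          _ = 0 := by rw [o2, mul_zero]
      · simp only [hW1, o1, one_apply, Fin.castSucc_inj]
    · ext a l
      rw [mul_diagonal, Matrix.mul_apply]
      refine Fin.lastCases ?_ (fun l => ?_) l
      · have := congrFun (congrFun hMG a) i
        rw [Matrix.mul_apply, Matrix.smul_apply, smul_eq_mul] at this
        simp only [hW2, Function.comp_apply, Fin.snoc_last]
        calc ∑ c, M a c * (z⁻¹ * G c i) = z⁻¹ * ∑ c, M a c * G c i := by
              rw [Finset.mul_sum]
              exact Finset.sum_congr rfl fun a _ => by ring
          _ = _ := by rw [this]; ring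
      · have := congrFun (congrFun hMV a) l
        rw [Matrix.mul_apply, mul_diagonal] at this
        simpa only [hW1, Function.comp_apply, Fin.snoc_castSucc] using this

end LinearAlgebra

end Isospectral

namespace Isospectral

/-! ### The Cayley transform over a commutative ring. -/

section Cayley

open Matrix

variable {ι R R' : Type*} [Fintype ι] [DecidableEq ι] [CommRing R] [CommRing R']

/-- The Cayley transform `(1 - S) (1 + S)⁻¹`. -/
noncomputable def cayley (S : Matrix ι ι R) : Matrix ι ι R := (1 - S) * (1 + S)⁻¹

theorem cayley_mul {S : Matrix ι ι R} (h : IsUnit (1 + S).det) : cayley S * (1 + S) = 1 - S := by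
  rw [cayley, mul_assoc, nonsing_inv_mul _ h, mul_one]

theorem eq_cayley {Q S : Matrix ι ι R} (h : IsUnit (1 + S).det) (hQ : Q * (1 + S) = 1 - S) :
    Q = cayley S := by
  rw [cayley, ← hQ, mul_assoc, mul_nonsing_inv _ h, mul_one]

theorem cayley_map (f : R →+* R') {S : Matrix ι ι R} (h : IsUnit (1 + S).det) :
    (cayley S).map f = cayley (S.map f) := by
  have h1 : f.mapMatrix (1 + S) = 1 + S.map f := by rw [map_add, map_one]; rfl
  have h2 : f.mapMatrix (1 - S) = 1 - S.map f := by rw [map_sub, map_one]; rfl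
  refine eq_cayley ?_ ?_
  · rw [← h1, ← RingHom.map_det]
    exact h.map f
  · rw [← h1, ← h2, ← cayley_mul h, map_mul]
    rfl

theorem cayley_transpose_mul {S : Matrix ι ι R} (h : IsUnit (1 + S).det) (hS : Sᵀ = -S) :
    (cayley S)ᵀ * cayley S = 1 := by
  have hc : Commute (1 + S) (1 - S) := by
    change (1 + S) * (1 - S) = (1 - S) * (1 + S)
    noncomm_ring
  have ht : (1 + S)ᵀ = 1 - S := by rw [transpose_add, transpose_one, hS, sub_eq_add_neg]
  have ht' : (1 - S)ᵀ = 1 + S := by rw [transpose_sub, transpose_one, hS, sub_neg_eq_add]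
  have h' : IsUnit (1 - S).det := by rwa [← ht, det_transpose]
  rw [cayley, transpose_mul, transpose_nonsing_inv, ht, ht']
  rw [mul_assoc, ← mul_assoc (1 + S), hc.eq, mul_assoc (1 - S), mul_nonsing_inv _ h, mul_one,
    nonsing_inv_mul _ h']

theorem det_cayley {S : Matrix ι ι R} (h : IsUnit (1 + S).det) (hS : Sᵀ = -S) :
    (cayley S).det = 1 := by
  have ht : (1 + S)ᵀ = 1 - S := by rw [transpose_add, transpose_one, hS, sub_eq_add_neg]
  have := congrArg det (cayley_mul h)
  rw [det_mul, ← ht, det_transpose] at this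
  exact h.mul_right_cancel (by rw [this, one_mul])

/-- The Cayley transform is an involution: 1 + S = 2(1 + Q)⁻¹ for S = `cayley Q`, and 2 is a unit in
a ℂ-algebra. -/
theorem exists_eq_cayley [Algebra ℂ R] {Q : Matrix ι ι R} (hQ : Qᵀ * Q = 1)
    (h : IsUnit (1 + Q).det) :
    ∃ S : Matrix ι ι R, Sᵀ = -S ∧ IsUnit (1 + S).det ∧ Q = cayley S := by
  have hinv : (1 + Q) * (1 + Q)⁻¹ = 1 := mul_nonsing_inv _ h
  have hinv' : (1 + Q)⁻¹ * (1 + Q) = 1 := nonsing_inv_mul _ h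
  have ht : (1 + Q)ᵀ = 1 + Qᵀ := by rw [transpose_add, transpose_one]
  have h2 : IsUnit (2 : R) := by
    have := (IsUnit.mk0 (2 : ℂ) two_ne_zero).map (algebraMap ℂ R)
    rwa [map_ofNat] at this
  have h1 : 1 + cayley Q = (2 : R) • (1 + Q)⁻¹ := by
    calc 1 + cayley Q = (1 + Q) * (1 + Q)⁻¹ + (1 - Q) * (1 + Q)⁻¹ := by rw [hinv, cayley]
      _ = (2 : R) • (1 + Q)⁻¹ := by
        rw [← add_mul, add_add_sub_cancel, one_add_one_eq_two, two_mul, two_smul]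
  have hu : IsUnit (1 + cayley Q).det := by
    rw [h1, det_smul]
    refine (h2.pow _).mul ?_
    exact (Matrix.isUnit_iff_isUnit_det _).mp ⟨⟨_, _, hinv', hinv⟩, rfl⟩
  refine ⟨cayley Q, ?_, hu, eq_cayley hu ?_⟩
  · have hl : (1 + Qᵀ) * (cayley Q)ᵀ * (1 + Q) = (1 + Qᵀ) * (-cayley Q) * (1 + Q) := by
      have e1 : (1 + Qᵀ) * (cayley Q)ᵀ = 1 - Qᵀ := by
        have := congrArg transpose (cayley_mul h)
        rwa [transpose_mul, ht, transpose_sub, transpose_one] at this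
      rw [e1, mul_assoc, neg_mul, cayley_mul h, neg_sub]
      simp only [mul_add, mul_sub, add_mul, sub_mul, one_mul, mul_one, hQ]
      abel
    have hu' : IsUnit (1 + Q) := (Matrix.isUnit_iff_isUnit_det _).mpr h
    have hu'' : IsUnit (1 + Qᵀ) := by
      rw [← ht, Matrix.isUnit_iff_isUnit_det, det_transpose]
      exact h
    exact hu''.mul_left_cancel (hu'.mul_right_cancel hl)
  · have : (1 - cayley Q) = Q * ((2 : R) • (1 + Q)⁻¹) := by
      calc 1 - cayley Q = (1 + Q) * (1 + Q)⁻¹ - (1 - Q) * (1 + Q)⁻¹ := by rw [hinv, cayley]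
        _ = _ := by
          rw [← sub_mul, add_sub_sub_cancel, ← two_mul, mul_assoc, mul_smul_comm, two_mul,
            two_smul]
    rw [h1, this]

end Cayley

/-! ### Rational parametrization of the model and primality of its ideal. -/

section Parametrization

open Matrix

variable {n : ℕ} {R : Type*}

/-- The coordinates of a symmetric matrix. -/
noncomputable def symCoord (M : Matrix (Fin n) (Fin n) R) (e : Sym2 (Fin n)) : R :=
  M e.out.1 e.out.2

theorem symCoord_mk {M : Matrix (Fin n) (Fin n) R} (hM : M.IsSymm) (i j : Fin n) :
    symCoord M s(i, j) = M i j := by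
  have h : s((s(i, j) : Sym2 (Fin n)).out.1, (s(i, j) : Sym2 (Fin n)).out.2) = s(i, j) :=
    Quot.out_eq _
  rw [symCoord]
  rcases Sym2.eq_iff.mp h with ⟨h1, h2⟩ | ⟨h1, h2⟩
  · rw [h1, h2]
  · rw [h1, h2, hM.apply]

theorem symMatrix_symCoord {M : Matrix (Fin n) (Fin n) R} (hM : M.IsSymm) :
    symMatrix (symCoord M) = M := by
  ext i j
  exact symCoord_mk hM i j

theorem symCoord_symMatrix (x : Sym2 (Fin n) → R) : symCoord (symMatrix x) = x := by
  ext e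
  induction e with
  | _ i j => exact symCoord_mk (symMatrix_isSymm x) i j

variable [CommRing R]

theorem isSymm_conj (Q : Matrix (Fin n) (Fin n) R) (c : Fin n → R) :
    (Q * diagonal c * Qᵀ).IsSymm := by
  simp [Matrix.IsSymm, transpose_mul, Matrix.mul_assoc]

/-- The generic skew-symmetric matrix. -/
noncomputable def genericSkew (n : ℕ) :
    Matrix (Fin n) (Fin n) (MvPolynomial (Fin n × Fin n) ℂ) :=
  of fun i j => X (i, j) - X (j, i)

theorem genericSkew_transpose : (genericSkew n)ᵀ = -genericSkew n := by
  ext i j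
  simp [genericSkew]

noncomputable abbrev cayleyDenom (n : ℕ) : MvPolynomial (Fin n × Fin n) ℂ :=
  (1 + genericSkew n).det

theorem cayleyDenom_ne_zero : cayleyDenom n ≠ 0 := by
  intro h
  have h1 := congrArg (eval (0 : Fin n × Fin n → ℂ)) h
  rw [cayleyDenom, RingHom.map_det, map_add, map_one, map_zero] at h1
  have h2 : (eval (0 : Fin n × Fin n → ℂ)).mapMatrix (genericSkew n) = 0 := by
    ext i j
    simp [genericSkew]
  rw [h2] at h1
  simp at h1

/-- The coordinate ring of the domain of the Cayley transform on skew-symmetric matrices. -/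
abbrev CayleyRing (n : ℕ) : Type := Localization.Away (cayleyDenom n)

theorem cayleyRing_isDomain : IsDomain (CayleyRing n) :=
  IsLocalization.isDomain_localization
    (powers_le_nonZeroDivisors_of_noZeroDivisors cayleyDenom_ne_zero)

noncomputable def genericOrthogonal (n : ℕ) : Matrix (Fin n) (Fin n) (CayleyRing n) :=
  cayley ((genericSkew n).map (algebraMap _ (CayleyRing n)))

theorem isUnit_det_genericSkew_map :
    IsUnit (1 + (genericSkew n).map (algebraMap _ (CayleyRing n))).det := by
  have h : (algebraMap _ (CayleyRing n)).mapMatrix (1 + genericSkew n)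
      = 1 + (genericSkew n).map (algebraMap _ (CayleyRing n)) := by
    rw [map_add, map_one]
    rfl
  rw [← h, ← RingHom.map_det]
  exact IsLocalization.Away.algebraMap_isUnit (cayleyDenom n)

/-- The point `Q diag(c) Qᵀ` of the model for a generic Cayley transform `Q`. -/
noncomputable def genericPoint (c : Fin n → ℂ) : Matrix (Fin n) (Fin n) (CayleyRing n) :=
  genericOrthogonal n * diagonal (fun i => algebraMap ℂ _ (c i)) * (genericOrthogonal n)ᵀ

theorem exists_algHom_genericOrthogonal_map [Algebra ℂ R] (z : Fin n × Fin n → R)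
    (hz : IsUnit (aeval (R := ℂ) z (cayleyDenom n))) :
    ∃ ψ : CayleyRing n →ₐ[ℂ] R, (∀ t, ψ (algebraMap _ _ t) = aeval (R := ℂ) z t) ∧
      (genericOrthogonal n).map ψ = cayley ((genericSkew n).map (aeval (R := ℂ) z)) := by
  have hu : ∀ y : Submonoid.powers (cayleyDenom n), IsUnit ((aeval (R := ℂ) z : _ →ₐ[ℂ] R) y) := by
    rintro ⟨_, k, rfl⟩
    simpa using hz.pow k
  refine ⟨IsLocalization.liftAlgHom hu, fun t => ?_, ?_⟩
  · simp
  · refine (cayley_map (IsLocalization.liftAlgHom hu : CayleyRing n →ₐ[ℂ] R).toRingHom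
      isUnit_det_genericSkew_map).trans ?_
    congr 1
    ext i j
    simp

theorem genericPoint_map [Algebra ℂ R] (ψ : CayleyRing n →ₐ[ℂ] R) (c : Fin n → ℂ) :
    (genericPoint c).map ψ = (genericOrthogonal n).map ψ
      * diagonal (fun i => algebraMap ℂ R (c i)) * ((genericOrthogonal n).map ψ)ᵀ := by
  change ψ.mapMatrix (genericPoint c) = _
  rw [genericPoint, map_mul, map_mul]
  congr 2
  change (diagonal _).map ψ = _
  rw [diagonal_map (map_zero ψ)]
  simp

/-- Every orthogonal matrix in the domain of the Cayley transform is a specialization of the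
generic one. -/
theorem exists_algHom_of_orthogonal [Algebra ℂ R] {Q : Matrix (Fin n) (Fin n) R} (hQ : Qᵀ * Q = 1)
    (h : IsUnit (1 + Q).det) (c : Fin n → ℂ) :
    ∃ ψ : CayleyRing n →ₐ[ℂ] R,
      (genericPoint c).map ψ = Q * diagonal (fun i => algebraMap ℂ R (c i)) * Qᵀ := by
  obtain ⟨S, hS, hu, rfl⟩ := exists_eq_cayley hQ h
  -- The generic skew matrix has entries x_ij - x_ji, so halving the entries of S specializes it to
  -- S.
  set z : Fin n × Fin n → R := fun p => (2⁻¹ : ℂ) • S p.1 p.2 with hz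
  have hSz : (genericSkew n).map (aeval (R := ℂ) z) = S := by
    ext i j
    have : S j i = - S i j := congrFun (congrFun hS i) j
    simp only [genericSkew, map_apply, of_apply, map_sub, aeval_X, hz, this]
    rw [smul_neg, sub_neg_eq_add, ← add_smul]
    norm_num
  have hd : aeval (R := ℂ) z (cayleyDenom n) = (1 + S).det := by
    rw [cayleyDenom, AlgHom.map_det, map_add, map_one]
    conv_rhs => rw [← hSz]
    rfl
  obtain ⟨ψ, -, hψ⟩ := exists_algHom_genericOrthogonal_map z (hd ▸ hu)
  exact ⟨ψ, by rw [genericPoint_map, hψ, hSz]⟩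

noncomputable def parametrization (c : Fin n → ℂ) : CoordRing n →ₐ[ℂ] CayleyRing n :=
  aeval (symCoord (genericPoint c))

theorem map_parametrization [Algebra ℂ R] (ψ : CayleyRing n →ₐ[ℂ] R) (c : Fin n → ℂ)
    (f : CoordRing n) :
    ψ (parametrization c f) = aeval (symCoord ((genericPoint c).map ψ)) f := by
  rw [parametrization, ← AlgHom.comp_apply, comp_aeval]
  rfl

/-- Multiplying an orthogonal matrix by a diagonal sign matrix brings it into the domain of the
Cayley transform without changing the corresponding point of the model. -/
theorem exists_orthogonal_isUnit_det {Q : Matrix (Fin n) (Fin n) ℂ} (hQ : Qᵀ * Q = 1)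
    (c : Fin n → ℂ) : ∃ Q' : Matrix (Fin n) (Fin n) ℂ, Q'ᵀ * Q' = 1 ∧ (1 + Q').det ≠ 0 ∧
      Q' * diagonal c * Q'ᵀ = Q * diagonal c * Qᵀ := by
  obtain ⟨e, he, hdet⟩ := exists_sign_det_ne_zero Q
  have hee : diagonal e * diagonal e = 1 := by
    rw [diagonal_mul_diagonal, ← diagonal_one]
    exact congrArg _ (funext he)
  refine ⟨Q * diagonal e, ?_, ?_, ?_⟩
  · rw [transpose_mul, diagonal_transpose, mul_assoc, ← mul_assoc Qᵀ, hQ, one_mul, hee]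
  · have : 1 + Q * diagonal e = (diagonal e + Q) * diagonal e := by rw [add_mul, hee]
    rw [this, det_mul]
    refine mul_ne_zero hdet fun h0 => ?_
    have := congrArg det hee
    rw [det_mul, h0, det_one, zero_mul] at this
    exact zero_ne_one this
  · have : diagonal e * diagonal c * diagonal e = diagonal c := by
      rw [diagonal_mul_diagonal, diagonal_mul_diagonal]
      congr 1
      ext i
      linear_combination c i * he i
    rw [transpose_mul, diagonal_transpose]
    conv_rhs => rw [← this]
    simp only [mul_assoc]

/-- Cayley transforms have determinant 1, so the parametrization lands in the model; after a change
of signs of columns, every point of the model is reached. -/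
theorem ker_parametrization (c : Fin n → ℂ) :
    RingHom.ker (parametrization c) = vanishingIdeal ℂ (modelPoints c) := by
  ext f
  rw [RingHom.mem_ker, mem_vanishingIdeal_iff]
  constructor
  · rintro hf x ⟨Q, hQ, hx⟩
    have hQ1 : Qᵀ * Q = 1 := by
      have := (mem_specialOrthogonalGroup_iff.mp hQ).1
      exact (mem_orthogonalGroup_iff' _ _).mp this
    obtain ⟨Q', hQ', hdet, hc⟩ := exists_orthogonal_isUnit_det hQ1 c
    obtain ⟨ψ, hψ⟩ := exists_algHom_of_orthogonal hQ' (IsUnit.mk0 _ hdet) c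
    have := map_parametrization ψ c f
    rw [hf, map_zero, hψ] at this
    simp only [Algebra.algebraMap_self, RingHom.id_apply] at this
    rw [hc, ← hx, symCoord_symMatrix] at this
    exact this.symm
  · intro hf
    obtain ⟨⟨t, y⟩, ht⟩ := IsLocalization.surj (Submonoid.powers (cayleyDenom n))
      (parametrization c f)
    -- The numerator t vanishes wherever the denominator does not, so their product vanishes on the
    -- whole affine space.
    have h0 : cayleyDenom n * t = 0 := by
      refine MvPolynomial.funext fun z => ?_
      rw [map_mul, map_zero]
      by_cases hz : eval z (cayleyDenom n) = 0
      · rw [hz, zero_mul]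
      · obtain ⟨ψ, hψ, hψ'⟩ := exists_algHom_genericOrthogonal_map z
          (by rw [aeval_eq_eval]; exact IsUnit.mk0 _ hz)
        have hS : ((genericSkew n).map (aeval (R := ℂ) z))ᵀ = -(genericSkew n).map (aeval (R := ℂ) z) := by
          rw [← transpose_map, genericSkew_transpose]
          ext i j
          simp
        have hu : IsUnit (1 + (genericSkew n).map (aeval (R := ℂ) z)).det := by
          have : (1 + (genericSkew n).map (aeval (R := ℂ) z)).det = aeval (R := ℂ) z (cayleyDenom n) := by
            rw [cayleyDenom, AlgHom.map_det, map_add, map_one]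
            rfl
          rw [this, aeval_eq_eval]
          exact IsUnit.mk0 _ hz
        have hp : ψ (parametrization c f) = 0 := by
          rw [map_parametrization]
          refine hf _ ?_
          rw [genericPoint_map, hψ', modelPoints, Set.mem_ofPred_eq,
            symMatrix_symCoord (isSymm_conj _ _)]
          refine ⟨_, ?_, rfl⟩
          exact mem_specialOrthogonalGroup_iff.mpr
            ⟨(mem_orthogonalGroup_iff' _ _).mpr (cayley_transpose_mul hu hS), det_cayley hu hS⟩
        have := congrArg ψ ht
        rw [map_mul, hp, zero_mul, hψ, aeval_eq_eval] at this
        rw [← this, mul_zero]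
    have ht0 : t = 0 := (mul_eq_zero.mp h0).resolve_left cayleyDenom_ne_zero
    subst ht0
    rw [map_zero] at ht
    exact (IsLocalization.map_units (CayleyRing n) y).mul_left_eq_zero.mp ht

theorem isPrime_vanishingIdeal_modelPoints (c : Fin n → ℂ) :
    (vanishingIdeal ℂ (modelPoints c) : Ideal (CoordRing n)).IsPrime := by
  have : IsDomain (CayleyRing n) := cayleyRing_isDomain
  rw [← ker_parametrization]
  exact RingHom.ker_isPrime _

end Parametrization

end Isospectral

namespace Isospectral

open Matrix Lagrange
open scoped Polynomial

/-! ### Points of the defining equations with values in ℂ-algebras. -/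

section Points

variable {n r : ℕ} {R : Type*} [CommRing R] [Algebra ℂ R]

/-- Determinant -1 does no harm: after a change of signs the matrix is a Cayley transform and has
determinant 1. -/
theorem mem_model_of_orthogonal {Q : Matrix (Fin n) (Fin n) ℂ} (hQ : Qᵀ * Q = 1)
    (c : Fin n → ℂ) : Q * diagonal c * Qᵀ ∈ model c := by
  obtain ⟨Q', hQ', hdet, hc⟩ := exists_orthogonal_isUnit_det hQ c
  obtain ⟨S, hS, hu, rfl⟩ := exists_eq_cayley hQ' (IsUnit.mk0 _ hdet)
  exact ⟨_, mem_specialOrthogonalGroup_iff.mpr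
    ⟨(mem_orthogonalGroup_iff' _ _).mpr hQ', det_cayley hu hS⟩, hc.symm⟩

theorem genericSym_map_aeval (x : Sym2 (Fin n) → R) :
    (genericSym n).map (aeval (R := ℂ) x) = symMatrix x := by
  ext i j
  simp [genericSym, symMatrix]

theorem minPolyMatrix_map (k : FlagType n r) (c : Fin n → ℂ) (ρ : CoordRing n →ₐ[ℂ] R) :
    (minPolyMatrix k c).map ρ = Polynomial.aeval ((genericSym n).map ρ)
      (nodal Finset.univ fun j => c (k.lastPos j)) := by
  change ρ.mapMatrix (minPolyMatrix k c) = _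
  rw [minPolyMatrix, map_list_prod, nodal_eq, ← List.prod_ofFn, map_list_prod, List.map_ofFn,
    List.map_ofFn]
  congr 2
  ext1 j
  simp only [Function.comp_apply, map_sub, Polynomial.aeval_X, Polynomial.aeval_C]
  congr 1
  ext a b
  by_cases hab : a = b
  · subst hab
    simp [algebraMap_matrix_apply, ← MvPolynomial.algebraMap_eq]
  · simp [algebraMap_matrix_apply, hab]

/-- The functor of points of the quotient by the defining ideal; it is applied over ℂ, over
thickenings of points, and modulo the square of the ideal. -/
theorem definingIdeal_le_ker_iff (k : FlagType n r) (c : Fin n → ℂ) (ρ : CoordRing n →ₐ[ℂ] R) :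
    definingIdeal k c ≤ RingHom.ker ρ ↔
      Polynomial.aeval ((genericSym n).map ρ) (nodal Finset.univ fun j => c (k.lastPos j)) = 0 ∧
      ((genericSym n).map ρ).trace = algebraMap ℂ R (∑ i, c i) := by
  have htr : ((genericSym n).map ρ).trace = ρ (genericSym n).trace :=
    (AddMonoidHom.map_trace ρ _).symm
  rw [definingIdeal, Ideal.span_le, Set.union_subset_iff, Set.range_subset_iff,
    Set.singleton_subset_iff, ← minPolyMatrix_map, htr]
  refine and_congr ?_ ?_
  · simp only [SetLike.mem_coe, RingHom.mem_ker, Prod.forall]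
    exact ⟨fun h => by ext i j; exact h i j, fun h i j => congrFun (congrFun h i) j⟩
  · rw [SetLike.mem_coe, RingHom.mem_ker, map_sub, sub_eq_zero, ← MvPolynomial.algebraMap_eq,
      AlgHom.commutes]

theorem mem_zeroLocus_definingIdeal_iff (k : FlagType n r) (c : Fin n → ℂ)
    (x : Sym2 (Fin n) → ℂ) : x ∈ zeroLocus ℂ (definingIdeal k c) ↔
      Polynomial.aeval (symMatrix x) (nodal Finset.univ fun j => c (k.lastPos j)) = 0 ∧
      (symMatrix x).trace = ∑ i, c i := by
  have := definingIdeal_le_ker_iff k c (aeval (R := ℂ) x)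
  rw [genericSym_map_aeval, Algebra.algebraMap_self, RingHom.id_apply] at this
  rw [← this]
  rfl

theorem aeval_mul_of_mul_eq {ι : Type*} [Fintype ι] [DecidableEq ι] {M D Q : Matrix ι ι R}
    (h : M * Q = Q * D) (f : ℂ[X]) :
    Polynomial.aeval M f * Q = Q * Polynomial.aeval D f := by
  induction f using Polynomial.induction_on' with
  | add p q hp hq => simp only [map_add, add_mul, mul_add, hp, hq]
  | monomial k a =>
    have hk : M ^ k * Q = Q * D ^ k := (SemiconjBy.pow_right (show SemiconjBy Q D M from h.symm) k).symm
    rw [Polynomial.aeval_monomial, Polynomial.aeval_monomial, mul_assoc, hk,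
      ← Algebra.smul_def, ← Algebra.smul_def, mul_smul_comm]

theorem aeval_diagonal_eq_zero {ι : Type*} [Fintype ι] [DecidableEq ι] {c : ι → ℂ} {f : ℂ[X]}
    (h : ∀ i, f.eval (c i) = 0) : Polynomial.aeval (diagonal c) f = 0 := by
  have h1 : Polynomial.aeval c f = 0 := by
    ext i
    have := Polynomial.aeval_algHom_apply (Pi.evalAlgHom ℂ (fun _ : ι => ℂ) i) c f
    simp only [Pi.evalAlgHom_apply] at this
    rw [← this]
    simpa using h i
  have := Polynomial.aeval_algHom_apply (diagonalAlgHom ℂ (n := ι) (α := ℂ)) c f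
  rw [h1, map_zero] at this
  exact this

end Points

/-! ### Blocks, multiplicities and the genericity condition. -/

namespace FlagType

variable {n r : ℕ} (k : FlagType n r)

theorem exists_block (i : Fin n) :
    ∃ j : Fin (r + 1), k.dim j.castSucc ≤ (i : ℕ) ∧ (i : ℕ) < k.dim j.succ := by
  have key : ∀ j : Fin (r + 2), (i : ℕ) < k.dim j →
      ∃ j : Fin (r + 1), k.dim j.castSucc ≤ (i : ℕ) ∧ (i : ℕ) < k.dim j.succ := by
    intro j
    induction j using Fin.induction with
    | zero => simp [k.dim_zero]
    | succ j ih =>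
      intro h
      by_cases h' : (i : ℕ) < k.dim j.castSucc
      · exact ih h'
      · exact ⟨j, not_lt.mp h', h⟩
  exact key (Fin.last _) (by rw [k.dim_last]; exact i.2)

/-- The block containing a position. -/
noncomputable def block (i : Fin n) : Fin (r + 1) := (k.exists_block i).choose

theorem dim_castSucc_block_le (i : Fin n) : k.dim (k.block i).castSucc ≤ i :=
  (k.exists_block i).choose_spec.1

theorem lt_dim_succ_block (i : Fin n) : (i : ℕ) < k.dim (k.block i).succ :=
  (k.exists_block i).choose_spec.2

theorem block_eq {i : Fin n} {j : Fin (r + 1)} (h₁ : k.dim j.castSucc ≤ i)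
    (h₂ : (i : ℕ) < k.dim j.succ) : k.block i = j := by
  have h₃ := (k.dim_castSucc_block_le i).trans_lt h₂
  have h₄ := h₁.trans_lt (k.lt_dim_succ_block i)
  rw [k.strictMono.lt_iff_lt] at h₃ h₄
  exact le_antisymm (Fin.castSucc_lt_succ_iff.mp h₃) (Fin.castSucc_lt_succ_iff.mp h₄)

theorem dim_castSucc_le_lastPos (j : Fin (r + 1)) : k.dim j.castSucc ≤ k.lastPos j := by
  have h : k.dim j.castSucc < k.dim j.succ := k.strictMono Fin.castSucc_lt_succ
  simp only [lastPos]
  omega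

theorem lastPos_lt_dim_succ (j : Fin (r + 1)) : (k.lastPos j : ℕ) < k.dim j.succ := by
  have h : k.dim j.castSucc < k.dim j.succ := k.strictMono Fin.castSucc_lt_succ
  simp only [lastPos]
  omega

theorem block_lastPos (j : Fin (r + 1)) : k.block (k.lastPos j) = j :=
  k.block_eq (k.dim_castSucc_le_lastPos j) (k.lastPos_lt_dim_succ j)

theorem IsBlockConstant.apply_lastPos_block {k : FlagType n r} {c : Fin n → ℂ}
    (h : k.IsBlockConstant c) (i : Fin n) : c (k.lastPos (k.block i)) = c i :=
  h _ _ _ (k.dim_castSucc_le_lastPos _) (k.lastPos_lt_dim_succ _) (k.dim_castSucc_block_le i)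
    (k.lt_dim_succ_block i)

theorem isBlockConstant_comp_block (B : Fin (r + 1) → ℂ) :
    k.IsBlockConstant fun i => B (k.block i) := by
  intro j i i' h₁ h₂ h₃ h₄
  change B (k.block i) = B (k.block i')
  rw [k.block_eq h₁ h₂, k.block_eq h₃ h₄]

/-- The sizes of the fibres of a map. -/
def fiberCard (s : Fin n → Fin (r + 1)) (j : Fin (r + 1)) : Fin (n + 1) :=
  ⟨(Finset.univ.filter fun i => s i = j).card,
    Nat.lt_succ_of_le ((Finset.card_le_univ _).trans_eq (Fintype.card_fin n))⟩

theorem sum_comp_eq_sum_fiberCard {R : Type*} [CommSemiring R] (s : Fin n → Fin (r + 1))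
    (B : Fin (r + 1) → R) : ∑ i, B (s i) = ∑ j, ((fiberCard s j : ℕ) : R) * B j := by
  have : ∀ i, B (s i) = ∑ j, if s i = j then B j else 0 := fun i => by simp
  simp_rw [this]
  rw [Finset.sum_comm]
  refine Finset.sum_congr rfl fun j _ => ?_
  rw [← Finset.sum_filter, Finset.sum_const, nsmul_eq_mul]
  rfl

theorem exists_perm_of_fiberCard_eq {s t : Fin n → Fin (r + 1)} (h : fiberCard s = fiberCard t) :
    ∃ σ : Equiv.Perm (Fin n), ∀ i, s (σ i) = t i := by
  have e : ∀ j, {i // t i = j} ≃ {i // s i = j} := fun j => Fintype.equivOfCardEq (by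
    rw [Fintype.card_subtype, Fintype.card_subtype]
    exact (congrArg Fin.val (congrFun h j)).symm)
  exact ⟨Equiv.ofFiberEquiv e, Equiv.ofFiberEquiv_map e⟩

open Classical in
/-- A polynomial that is nonzero exactly when the values on different blocks are distinct and the
trace determines the multiplicities of the eigenvalues. -/
noncomputable def discriminant : MvPolynomial (Fin n) ℂ :=
  (∏ p : Fin (r + 1) × Fin (r + 1) with p.1 ≠ p.2, (X (k.lastPos p.1) - X (k.lastPos p.2))) *
    ∏ s : Fin n → Fin (r + 1) with fiberCard s ≠ fiberCard k.block,
      (∑ i, X (k.lastPos (s i)) - ∑ i, X i)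

theorem eval_discriminant_ne_zero_iff (c : Fin n → ℂ) : eval c k.discriminant ≠ 0 ↔
    Function.Injective (fun j => c (k.lastPos j)) ∧
      ∀ s : Fin n → Fin (r + 1), ∑ i, c (k.lastPos (s i)) = ∑ i, c i →
        fiberCard s = fiberCard k.block := by
  rw [discriminant, map_mul, mul_ne_zero_iff, map_prod, map_prod, Finset.prod_ne_zero_iff,
    Finset.prod_ne_zero_iff]
  refine and_congr ?_ ?_
  · simp only [Finset.mem_filter, Finset.mem_univ, true_and, Prod.forall, map_sub, eval_X,
      sub_ne_zero]
    exact forall₂_congr fun i j => not_imp_not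
  · simp only [Finset.mem_filter, Finset.mem_univ, true_and, map_sub, map_sum, eval_X,
      sub_ne_zero]
    exact forall_congr' fun s => not_imp_not

/-- With block values (n + 1)^j, the multiplicities, all at most n, are the base n + 1 digits of the
trace. -/
theorem exists_eval_discriminant_ne_zero :
    ∃ c, k.IsBlockConstant c ∧ eval c k.discriminant ≠ 0 := by
  refine ⟨_, k.isBlockConstant_comp_block fun j => ((n : ℂ) + 1) ^ (j : ℕ), ?_⟩
  have hn : 0 < n := (Nat.zero_le _).trans_lt (k.lastPos 0).2
  rw [eval_discriminant_ne_zero_iff]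
  simp only [block_lastPos]
  refine ⟨fun i j (hij : ((n : ℂ) + 1) ^ (i : ℕ) = ((n : ℂ) + 1) ^ (j : ℕ)) => ?_, fun s hs => ?_⟩
  · have h : (n + 1) ^ (i : ℕ) = (n + 1) ^ (j : ℕ) := by exact_mod_cast hij
    exact Fin.ext (Nat.pow_right_injective (by omega) h)
  · rw [sum_comp_eq_sum_fiberCard s fun j : Fin (r + 1) => ((n : ℂ) + 1) ^ (j : ℕ),
      sum_comp_eq_sum_fiberCard k.block fun j : Fin (r + 1) => ((n : ℂ) + 1) ^ (j : ℕ)] at hs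
    refine finFunctionFinEquiv.injective (Fin.ext ?_)
    rw [finFunctionFinEquiv_apply, finFunctionFinEquiv_apply]
    exact_mod_cast hs

end FlagType

/-! ### Zero set of the equations and generation of the vanishing ideal. -/

section Main

variable {n r : ℕ} {k : FlagType n r} {c : Fin n → ℂ}

theorem zeroLocus_definingIdeal (hc : k.IsBlockConstant c) (hg : eval c k.discriminant ≠ 0) :
    zeroLocus ℂ (definingIdeal k c) = modelPoints c := by
  obtain ⟨hb, hsep⟩ := (k.eval_discriminant_ne_zero_iff c).mp hg
  ext x
  rw [mem_zeroLocus_definingIdeal_iff]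
  constructor
  · rintro ⟨hx, htr⟩
    obtain ⟨V, s, hV, hMV⟩ := exists_orthonormal_eigenvectors hb (symMatrix_isSymm x) hx n (by simp)
    have hM : symMatrix x = V * diagonal ((fun j => c (k.lastPos j)) ∘ s) * Vᵀ := by
      rw [← hMV, mul_assoc, mul_eq_one_comm.mp hV, mul_one]
    rw [hM, trace_mul_comm, ← mul_assoc, hV, one_mul, trace_diagonal] at htr
    obtain ⟨σ, hσ⟩ := FlagType.exists_perm_of_fiberCard_eq (hsep s htr)
    have hcs : ∀ i, c i = c (k.lastPos (s (σ i))) := fun i => by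
      rw [hσ, hc.apply_lastPos_block]
    -- Equal multiplicities allow the eigenvectors to be permuted so that the eigenvalues appear in
    -- the order of `c`.
    have hM' : symMatrix x = V.submatrix id σ * diagonal c * (V.submatrix id σ)ᵀ := by
      rw [hM]
      ext i j
      rw [Matrix.mul_apply, Matrix.mul_apply, ← Equiv.sum_comp σ]
      simp only [mul_diagonal, Function.comp_apply, transpose_apply, submatrix_apply, id_eq, ← hcs]
    change symMatrix x ∈ model c
    rw [hM']
    refine mem_model_of_orthogonal ?_ c
    exact (submatrix_mul_equiv Vᵀ V σ (Equiv.refl _) σ).trans (by rw [hV]; simp)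
  · rintro ⟨Q, hQ, hx⟩
    have hQ1 : Qᵀ * Q = 1 := (mem_orthogonalGroup_iff' _ _).mp (mem_specialOrthogonalGroup_iff.mp hQ).1
    have hQ2 : Q * Qᵀ = 1 := mul_eq_one_comm.mp hQ1
    rw [hx]
    refine ⟨?_, ?_⟩
    · have h1 : Q * diagonal c * Qᵀ * Q = Q * diagonal c := by rw [mul_assoc, hQ1, mul_one]
      have h2 := aeval_mul_of_mul_eq h1 (nodal Finset.univ fun j => c (k.lastPos j))
      rw [aeval_diagonal_eq_zero, mul_zero] at h2
      · have := congrArg (· * Qᵀ) h2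
        simpa only [mul_assoc, hQ2, mul_one, zero_mul] using this
      · intro i
        rw [← hc.apply_lastPos_block i]
        exact eval_nodal_at_node (v := fun j => c (k.lastPos j)) (Finset.mem_univ _)
    · rw [trace_mul_comm, ← mul_assoc, hQ1, one_mul, trace_diagonal]

/-- Over an infinitesimal thickening of a point, a symmetric matrix annihilated by a separable
polynomial is orthogonally conjugate to a constant matrix. -/
theorem exists_orthogonal_conj_constant {R ι κ : Type*} [CommRing R] [Algebra ℂ R] [Fintype ι]
    [DecidableEq ι] [Fintype κ] [DecidableEq κ] (π : R →ₐ[ℂ] ℂ) {N : ℕ}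
    (hπ : RingHom.ker π ^ N = ⊥) {b : κ → ℂ} (hb : Function.Injective b) {M : Matrix ι ι R}
    (hs : M.IsSymm) (hM : Polynomial.aeval M (nodal Finset.univ b) = 0) :
    ∃ Q : Matrix ι ι R, Qᵀ * Q = 1 ∧ Q.map π = 1 ∧
      M = Q * (M.map π).map (algebraMap ℂ R) * Qᵀ := by
  refine exists_orthogonal_conj_of_map_eq π hπ hb hs ?_ hM ?_ ?_
  · rw [Matrix.IsSymm, ← transpose_map, ← transpose_map, hs.eq]
  · have h1 := aeval_map_algHom (Algebra.ofId ℂ R) (M.map π) (nodal Finset.univ b)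
    rw [← aeval_map_algHom, hM] at h1
    refine h1.symm.trans ?_
    ext i j
    simp
  · ext i j
    simp

theorem isUnit_of_isNilpotent_ker {R : Type*} [CommRing R] [Algebra ℂ R] (π : R →ₐ[ℂ] ℂ) {N : ℕ}
    (hπ : RingHom.ker π ^ N = ⊥) {a : R} (ha : π a ≠ 0) : IsUnit a := by
  have h1 : IsNilpotent (a - algebraMap ℂ R (π a)) := by
    refine ⟨N, ?_⟩
    rw [← Ideal.mem_bot, ← hπ]
    exact Ideal.pow_mem_pow (by simp [RingHom.mem_ker]) N
  have h2 : IsUnit (algebraMap ℂ R (π a)) := (IsUnit.mk0 _ ha).map _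
  have := h1.isUnit_add_left_of_commute h2 (Commute.all _ _)
  simpa using this

theorem vanishingIdeal_le_definingIdeal (hc : k.IsBlockConstant c)
    (hg : eval c k.discriminant ≠ 0) : vanishingIdeal ℂ (modelPoints c) ≤ definingIdeal k c := by
  have hb := ((k.eval_discriminant_ne_zero_iff c).mp hg).1
  intro f hf
  rw [← ker_parametrization, RingHom.mem_ker] at hf
  rw [← Ideal.Quotient.eq_zero_iff_mem]
  refine eq_zero_of_forall_infinitesimal _ fun J π N hπ => ?_
  let ρ : CoordRing n →ₐ[ℂ] ((CoordRing n ⧸ definingIdeal k c) ⧸ J) :=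
    (Ideal.Quotient.mkₐ ℂ J).comp (Ideal.Quotient.mkₐ ℂ (definingIdeal k c))
  change ρ f = 0
  have hle : definingIdeal k c ≤ RingHom.ker ρ := fun a ha => by
    rw [RingHom.mem_ker]
    change Ideal.Quotient.mk J (Ideal.Quotient.mk _ a) = 0
    rw [Ideal.Quotient.eq_zero_iff_mem.mpr ha, map_zero]
  set M := (genericSym n).map ρ with hM
  have hs : M.IsSymm := by
    have hgs : (genericSym n)ᵀ = genericSym n := symMatrix_isSymm _
    rw [Matrix.IsSymm, hM, ← transpose_map, hgs]
  obtain ⟨Q, hQ, hQπ, hMQ⟩ := exists_orthogonal_conj_constant π hπ hb hs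
    ((definingIdeal_le_ker_iff k c ρ).mp hle).1
  have hM0 : M.map π ∈ model c := by
    have hx : (fun e => π (ρ (X e))) ∈ zeroLocus ℂ (definingIdeal k c) := by
      intro a ha
      have h1 : aeval (fun e => π (ρ (X e))) a = π (ρ a) := by
        change _ = (π.comp ρ) a
        rw [aeval_unique (π.comp ρ)]
        rfl
      rw [h1, RingHom.mem_ker.mp (hle ha), map_zero]
    rw [zeroLocus_definingIdeal hc hg] at hx
    exact hx
  obtain ⟨Q₀, hQ₀, hMQ₀⟩ := hM0
  obtain ⟨Q₁, hQ₁, hdet, hc₁⟩ := exists_orthogonal_isUnit_det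
    ((mem_orthogonalGroup_iff' _ _).mp (mem_specialOrthogonalGroup_iff.mp hQ₀).1) c
  rw [← hc₁] at hMQ₀
  set Q₂ := Q₁.map (algebraMap ℂ ((CoordRing n ⧸ definingIdeal k c) ⧸ J)) with hQ₂
  have hQ₂t : Q₂ᵀ * Q₂ = 1 := by
    have := congrArg (algebraMap ℂ ((CoordRing n ⧸ definingIdeal k c) ⧸ J)).mapMatrix hQ₁
    rwa [map_mul, map_one] at this
  have hQ₂π : Q₂.map π = Q₁ := by
    ext i j
    simp [hQ₂]
  have hQQ : (Q * Q₂)ᵀ * (Q * Q₂) = 1 := by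
    rw [transpose_mul, mul_assoc, ← mul_assoc Qᵀ, hQ, one_mul, hQ₂t]
  -- Q reduces to 1 at the closed point, where the determinant becomes that of 1 + Q₁, nonzero by
  -- the choice of signs; the kernel of π is nilpotent.
  have hunit : IsUnit (1 + Q * Q₂).det := by
    refine isUnit_of_isNilpotent_ker π hπ ?_
    rw [AlgHom.map_det, map_add, map_mul, map_one]
    change (1 + Q.map π * Q₂.map π).det ≠ 0
    rwa [hQπ, one_mul, hQ₂π]
  obtain ⟨ψ, hψ⟩ := exists_algHom_of_orthogonal hQQ hunit c
  have hψM : (genericPoint c).map ψ = M := by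
    have h1 : (M.map π).map (algebraMap ℂ ((CoordRing n ⧸ definingIdeal k c) ⧸ J))
        = Q₂ * diagonal (fun i => algebraMap ℂ _ (c i)) * Q₂ᵀ := by
      rw [hMQ₀]
      change (algebraMap ℂ _).mapMatrix _ = _
      rw [map_mul, map_mul]
      change Q₂ * (diagonal c).map (algebraMap ℂ _) * _ = _
      rw [diagonal_map (map_zero _)]
      rfl
    rw [hψ, hMQ, h1, transpose_mul]
    simp only [mul_assoc]
  have h2 := map_parametrization ψ c f
  rw [hf, map_zero, hψM] at h2
  rw [h2, aeval_unique ρ]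
  congr 2
  ext e
  have : M = symMatrix fun e => ρ (X e) := rfl
  rw [this, symCoord_symMatrix]
  rfl

theorem vanishingIdeal_modelPoints (hc : k.IsBlockConstant c) (hg : eval c k.discriminant ≠ 0) :
    vanishingIdeal ℂ (modelPoints c) = definingIdeal k c :=
  le_antisymm (vanishingIdeal_le_definingIdeal hc hg)
    (le_zeroLocus_iff_le_vanishingIdeal.mp (zeroLocus_definingIdeal hc hg).ge)

end Main

end Isospectral

/-! ### Smoothness by Newton lifting. -/

namespace Isospectral

open Matrix Lagrange
open scoped Polynomial

/-- A Newton step for a separable polynomial. -/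
theorem exists_newton_step {p : ℂ[X]} (hp : p.Separable) :
    ∃ h : ℂ[X], p ∣ h - Polynomial.X ∧ p ^ 2 ∣ p.comp h := by
  obtain ⟨t, s, hts⟩ := hp
  obtain ⟨q, hq⟩ := (p.map Polynomial.C).binomExpansion Polynomial.X (-(p * s))
  -- With tp + sp' = 1, Taylor expansion gives p(X - ps) = p(1 - sp') + q p²s² = p²(t + qs²).
  refine ⟨Polynomial.X + -(p * s), ⟨-s, by ring⟩, t + q * s ^ 2, ?_⟩
  have h1 : p.comp (Polynomial.X + -(p * s))
      = (p.map Polynomial.C).eval (Polynomial.X + -(p * s)) := by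
    rw [Polynomial.comp, Polynomial.eval_map]
  rw [h1, hq, Polynomial.derivative_map, Polynomial.eval_map, Polynomial.eval_map,
    Polynomial.eval₂_C_X, Polynomial.eval₂_C_X]
  linear_combination -p * hts

theorem aeval_eq_self_of_dvd {A : Type*} [Ring A] [Algebra ℂ A] {x : A} {p h : ℂ[X]}
    (hx : Polynomial.aeval x p = 0) (hh : p ∣ h - Polynomial.X) : Polynomial.aeval x h = x := by
  obtain ⟨q, hq⟩ := hh
  have := congrArg (Polynomial.aeval x) hq
  rwa [map_sub, Polynomial.aeval_X, map_mul, hx, zero_mul, sub_eq_zero] at this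

/-- The trace of a symmetric matrix that is annihilated by a separable polynomial is determined by
its values at closed points. -/
theorem trace_eq_of_forall_point {B ι κ : Type*} [CommRing B] [Algebra ℂ B]
    [Algebra.FiniteType ℂ B] [Fintype ι] [DecidableEq ι] [Fintype κ] [DecidableEq κ] {b : κ → ℂ}
    (hb : Function.Injective b) {M : Matrix ι ι B} (hs : M.IsSymm)
    (hM : Polynomial.aeval M (nodal Finset.univ b) = 0) (τ : ℂ)
    (h : ∀ χ : B →ₐ[ℂ] ℂ, (M.map χ).trace = τ) : M.trace = algebraMap ℂ B τ := by
  rw [← sub_eq_zero]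
  refine eq_zero_of_forall_infinitesimal _ fun J π N hπ => ?_
  set φ := Ideal.Quotient.mkₐ ℂ J with hφ
  change φ _ = 0
  have hs' : (M.map φ).IsSymm := by rw [Matrix.IsSymm, ← transpose_map, hs.eq]
  have hM' : Polynomial.aeval (M.map φ) (nodal Finset.univ b) = 0 := by
    rw [← aeval_map_algHom, hM]
    ext i j
    simp
  obtain ⟨Q, hQ, -, hMQ⟩ := exists_orthogonal_conj_constant π hπ hb hs' hM'
  -- Orthogonal conjugation preserves the trace, so the trace is that of the constant matrix at the
  -- closed point.
  have htr := congrArg trace hMQ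
  rw [trace_mul_comm, ← mul_assoc, hQ, one_mul] at htr
  have h1 : (M.map φ).trace = φ M.trace := (AddMonoidHom.map_trace φ _).symm
  have h2 : (((M.map φ).map π).map (algebraMap ℂ (B ⧸ J))).trace
      = algebraMap ℂ (B ⧸ J) ((M.map φ).map π).trace :=
    (AddMonoidHom.map_trace (algebraMap ℂ (B ⧸ J)) _).symm
  have h3 : ((M.map φ).map π).trace = τ := h (π.comp φ)
  rw [map_sub, AlgHom.commutes, ← h1, htr, h2, h3, sub_self]

variable {n r : ℕ}

/-- Formal smoothness amounts to splitting P/J² → P/J, for P the polynomial ring and J the defining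
ideal. Modulo J² the matrix of unknowns satisfies p only up to square-zero error; one Newton step
yields an exact solution with the same reduction, which defines the section. -/
theorem smooth_quotient_definingIdeal (k : FlagType n r) {c : Fin n → ℂ}
    (hb : Function.Injective fun j => c (k.lastPos j)) :
    Algebra.Smooth ℂ (CoordRing n ⧸ definingIdeal k c) := by
  have hfp : Algebra.FinitePresentation ℂ (CoordRing n ⧸ definingIdeal k c) :=
    Algebra.FinitePresentation.of_finiteType.mp inferInstance
  refine ⟨?_, hfp⟩
  set f := Ideal.Quotient.mkₐ ℂ (definingIdeal k c) with hf
  have hfs : Function.Surjective f := Ideal.Quotient.mkₐ_surjective _ _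
  rw [Algebra.FormallySmooth.iff_split_surjection f hfs]
  set p := nodal Finset.univ fun j => c (k.lastPos j) with hp
  have hpsep : p.Separable := by
    rw [hp, nodal_eq]
    exact Polynomial.separable_prod_X_sub_C_iff.mpr hb
  obtain ⟨h, hh, hh2⟩ := exists_newton_step hpsep
  set J := RingHom.ker f.toRingHom with hJ
  have hJI : ∀ a, a ∈ J ↔ a ∈ definingIdeal k c := fun a => Ideal.Quotient.eq_zero_iff_mem
  set φ := Ideal.Quotient.mkₐ ℂ (J ^ 2) with hφ
  set M₀ := (genericSym n).map φ with hM₀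
  have hgs : (genericSym n)ᵀ = genericSym n := symMatrix_isSymm _
  have hM₀s : M₀ᵀ = M₀ := by rw [hM₀, ← transpose_map, hgs]
  set M := Polynomial.aeval M₀ h with hM
  have hMs : M.IsSymm := by rw [Matrix.IsSymm, hM, transpose_aeval, hM₀s]
  have hfker := (definingIdeal_le_ker_iff k c f).mp fun a ha => (hJI a).mpr ha
  have hsq : Polynomial.aeval M₀ p ^ 2 = 0 := by
    have hmem : ∀ i j, (Polynomial.aeval M₀ p) i j ∈ J.map φ := by
      intro i j
      rw [hM₀, ← aeval_map_algHom]
      refine Ideal.mem_map_of_mem _ ?_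
      have := congrFun (congrFun hfker.1 i) j
      rw [← aeval_map_algHom] at this
      exact this
    ext i j
    have := pow_apply_mem_pow hmem 2 i j
    rw [← Ideal.map_pow] at this
    have h0 : (J ^ 2).map φ = ⊥ := Ideal.map_quotient_self _
    rwa [h0, Ideal.mem_bot] at this
  have hMp : Polynomial.aeval M p = 0 := by
    rw [hM, ← Polynomial.aeval_comp]
    obtain ⟨q, hq⟩ := hh2
    rw [hq, map_mul, map_pow, hsq, zero_mul]
  have htr : M.trace = algebraMap ℂ _ (∑ i, c i) := by
    refine trace_eq_of_forall_point hb hMs hMp _ fun χ => ?_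
    -- A ℂ-point of P/J² kills the nilpotent ideal J/J², so it is a point of the original equations,
    -- where the trace is known and the Newton step changes nothing.
    have hle : definingIdeal k c ≤ RingHom.ker (χ.comp φ) := by
      intro a ha
      have h1 : φ a ^ 2 = 0 := by
        rw [← map_pow]
        exact Ideal.Quotient.eq_zero_iff_mem.mpr (Ideal.pow_mem_pow ((hJI a).mpr ha) 2)
      have h2 : χ (φ a) ^ 2 = 0 := by rw [← map_pow, h1, map_zero]
      exact pow_eq_zero_iff two_ne_zero |>.mp h2
    obtain ⟨e1, e2⟩ := (definingIdeal_le_ker_iff k c (χ.comp φ)).mp hle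
    rw [hM, aeval_map_algHom]
    change (Polynomial.aeval ((genericSym n).map (χ.comp φ)) h).trace = _
    rw [aeval_eq_self_of_dvd e1 hh, e2]
    rfl
  have hle : definingIdeal k c ≤ RingHom.ker (aeval (R := ℂ) (symCoord M)) := by
    rw [definingIdeal_le_ker_iff, genericSym_map_aeval, symMatrix_symCoord hMs]
    exact ⟨hMp, htr⟩
  refine ⟨Ideal.Quotient.liftₐ _ (aeval (symCoord M)) fun a ha => hle ha, ?_⟩
  refine Ideal.Quotient.algHom_ext _ (MvPolynomial.algHom_ext fun e => ?_)
  change f.kerSquareLift (aeval (symCoord M) (X e)) = f (X e)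
  rw [aeval_X]
  have hMf : M.map f.kerSquareLift = (genericSym n).map f := by
    rw [hM, aeval_map_algHom]
    exact aeval_eq_self_of_dvd hfker.1 hh
  change symCoord (M.map f.kerSquareLift) e = _
  rw [hMf]
  exact congrFun (symCoord_symMatrix fun e => f (X e)) e

end Isospectral

theorem theorem2p6 {n r : ℕ} (k : Isospectral.FlagType n r) :
    k.Generic fun c =>
      -- the model is a Zariski closed set
      MvPolynomial.zeroLocus ℂ (MvPolynomial.vanishingIdeal ℂ (Isospectral.modelPoints c)) =
        Isospectral.modelPoints c ∧
      -- it is smooth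
      Algebra.Smooth ℂ
        (Isospectral.CoordRing n ⧸ MvPolynomial.vanishingIdeal ℂ (Isospectral.modelPoints c)) ∧
      -- its ideal is prime
      (MvPolynomial.vanishingIdeal ℂ (Isospectral.modelPoints c) :
        Ideal (Isospectral.CoordRing n)).IsPrime ∧
      -- its ideal has the claimed generators
      MvPolynomial.vanishingIdeal ℂ (Isospectral.modelPoints c) =
        Isospectral.definingIdeal k c := by

  refine ⟨k.discriminant, k.exists_eval_discriminant_ne_zero, fun c hc hg => ?_⟩
  have hI := Isospectral.vanishingIdeal_modelPoints hc hg
  refine ⟨?_, ?_, Isospectral.isPrime_vanishingIdeal_modelPoints c, hI⟩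
  · rw [hI, Isospectral.zeroLocus_definingIdeal hc hg]
  · rw [hI]
    exact Isospectral.smooth_quotient_definingIdeal k
      ((k.eval_discriminant_ne_zero_iff c).mp hg).1
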